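/- Let $R$ be a Prüfer domain (an integral domain in which every nonzero finitely generated ideal is invertible) with quotient field $K$; fields are allowed. A \emph{semistar operation} on $R$ is a map $\star\colon I\mapsto I^\star$ from the set of all $R$-submodules of $K$ to itself such that, for all $R$-submodules $I,J$ of $K$ and all $x\in K$: $I\subseteq I^\star$; $(I^\star)^\star=I^\star$; $I\subseteq J$ implies $I^\star\subseteq J^\star$; and $(xI)^\star=x\cdot I^\star$. Semistar operations are ordered by $\star_1\le\star_2$ if and only if $I^{\star_1}\subseteq I^{\star_2}$ for all $I$; the infimum of a nonempty set $X$ of semistar operations is $\inf X\colon I\mapsto\bigcap_{\star\in X}I^\star$. A semistar operation $\star$ is \emph{stable} if $(I\cap J)^\star=I^\star\cap J^\star$ for all $R$-submodules $I,J$ of $K$. Let $\mathrm{SStar}_{st}(R)$ be the ordered set of stable semistar operations on $R$. For every semistar operation $\star$, $R^\star$ is a subring of $K$ containing $R$. Let $\mathrm{SStar}_{val}(R)$ be the set of semistar operations $\star$ on $R$ such that $R^\star$ is a valuation domain (a field counts as a valuation domain), and let $\mathcal X(R)$ be the set of all nonempty subsets $X\subseteq\mathrm{SStar}_{val}(R)$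 that are up-closed, i.e., such that $\star\in X$, $\star'\in\mathrm{SStar}_{val}(R)$ and $\star\le\star'$ imply $\star'\in X$. Order $\mathcal X(R)$ by reverse inclusion: $X\le Y$ if and only if $X\supseteq Y$. Consider $$\Psi\colon\mathcal X(R)\longrightarrow\mathrm{SStar}_{st}(R),\qquad X\longmapsto\inf X.$$ Then: (a) $\Psi$ is well defined (that is, $\inf X$ is a stable semistar operation for every $X\in\mathcal X(R)$) and order-preserving; (b) if every proper ideal of $R$ has only finitely many minimal primes, then $\Psi$ is surjective; (c) if $\mathrm{Spec}(R)$ is a Noetherian topological space, then $\Psi$ is an order isomorphism. -/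

import Mathlib

open scoped Pointwise nonZeroDivisors

/-- A Prüfer domain: an integral domain all of whose nonzero finitely generated ideals are
invertible (as fractional ideals). -/
def IsPruferDomain (R : Type*) [CommRing R] [IsDomain R] : Prop :=
  ∀ I : Ideal R, I.FG → I ≠ ⊥ → IsUnit (I : FractionalIdeal R⁰ (FractionRing R))

/-- A semistar operation on the domain `R` with quotient field `K`: a closure operation
`I ↦ I^⋆` on the set of all `R`-submodules of `K` such that `(xI)^⋆ = x I^⋆` for all `x ∈ K`. -/
structure SemistarOperation (R K : Type*) [CommRing R] [Field K] [Algebra R K] where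
  /-- The map `I ↦ I^⋆`. -/
  star : Submodule R K → Submodule R K
  le_star : ∀ I, I ≤ star I
  star_star : ∀ I, star (star I) = star I
  star_mono : ∀ I J, I ≤ J → star I ≤ star J
  star_smul : ∀ (x : K) (I : Submodule R K), star (x • I) = x • star I

namespace SemistarOperation

variable {R K : Type*} [CommRing R] [Field K] [Algebra R K]

theorem star_injective :
    Function.Injective (star : SemistarOperation R K → Submodule R K → Submodule R K) := by
  rintro ⟨_, _, _, _, _⟩ ⟨_, _, _, _, _⟩ h
  cases h
  rfl

/-- `⋆₁ ≤ ⋆₂` if and only if `I^⋆₁ ⊆ I^⋆₂` for all `R`-submodules `I` of `K`. -/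
instance : PartialOrder (SemistarOperation R K) where
  le s t := ∀ I, s.star I ≤ t.star I
  le_refl _ _ := le_rfl
  le_trans _ _ _ h h' I := (h I).trans (h' I)
  le_antisymm _ _ h h' := star_injective (funext fun I => le_antisymm (h I) (h' I))

/-- The zero submodule is closed (take `x = 0` in the last axiom). -/
theorem star_bot (s : SemistarOperation R K) : s.star ⊥ = ⊥ := by
  have h := s.star_smul 0 ⊥
  rwa [zero_smul, zero_smul] at h

/-- A semistar operation is stable if it distributes over finite intersections. -/
def IsStable (s : SemistarOperation R K) : Prop :=
  ∀ I J : Submodule R K, s.star (I ⊓ J) = s.star I ⊓ s.star J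

theorem mul_mem_star_one (s : SemistarOperation R K) {a b : K}
    (ha : a ∈ s.star 1) (hb : b ∈ s.star 1) : a * b ∈ s.star 1 := by
  have h1 : a • (1 : Submodule R K) ≤ s.star 1 := by
    intro y hy
    obtain ⟨z, hz, rfl⟩ := Submodule.mem_smul_pointwise_iff_exists _ _ _ |>.mp hy
    obtain ⟨r, rfl⟩ := Submodule.mem_one.mp hz
    rw [smul_eq_mul, mul_comm, ← Algebra.smul_def]
    exact Submodule.smul_mem _ r ha
  have h2 := s.star_mono _ _ h1
  rw [s.star_smul, s.star_star] at h2
  exact h2 (Submodule.smul_mem_pointwise_smul b a _ hb)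

/-- The overring `R^⋆` of `R`, where `R` is identified with its image `1` in `K`. -/
def overring (s : SemistarOperation R K) : Subalgebra R K where
  carrier := s.star 1
  mul_mem' := s.mul_mem_star_one
  add_mem' := (s.star 1).add_mem
  algebraMap_mem' r := s.le_star 1 (Submodule.mem_one.mpr ⟨r, rfl⟩)

/-- The infimum of a nonempty set `X` of semistar operations: `I ↦ ⋂_{⋆ ∈ X} I^⋆`. -/
def infimum (X : Set (SemistarOperation R K)) (hX : X.Nonempty) : SemistarOperation R K where
  star I := ⨅ s ∈ X, s.star I
  le_star I := le_iInf₂ fun s _ => s.le_star I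
  star_star I := by
    refine le_antisymm (le_iInf₂ fun s hs => ?_) (le_iInf₂ fun s _ => s.le_star _)
    refine (iInf₂_le s hs).trans ?_
    calc s.star (⨅ t ∈ X, t.star I) ≤ s.star (s.star I) := s.star_mono _ _ (iInf₂_le s hs)
      _ = s.star I := s.star_star I
  star_mono I J h := iInf₂_mono fun s _ => s.star_mono I J h
  star_smul x I := by
    rcases eq_or_ne x 0 with rfl | hx
    · rw [zero_smul, zero_smul]
      obtain ⟨s, hs⟩ := hX
      exact le_bot_iff.mp ((iInf₂_le s hs).trans (s.star_bot).le)
    · ext y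
      have key : ∀ N : Submodule R K, y ∈ x • N ↔ x⁻¹ * y ∈ N := by
        intro N
        rw [Submodule.mem_smul_pointwise_iff_exists]
        constructor
        · rintro ⟨z, hz, rfl⟩
          simpa [smul_eq_mul, hx] using hz
        · intro h
          exact ⟨_, h, by simp [smul_eq_mul, hx]⟩
      simp only [key, Submodule.mem_iInf, star_smul]

/-- `infimum X` is the greatest lower bound of `X` among all semistar operations. -/
theorem isGLB_infimum (X : Set (SemistarOperation R K)) (hX : X.Nonempty) :
    IsGLB X (infimum X hX) :=
  ⟨fun s hs _ => iInf₂_le s hs, fun _ ht I => le_iInf₂ fun _ hs => ht hs I⟩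

end SemistarOperation

/-- The partially ordered set of stable semistar operations on `R`. -/
abbrev StableSemistar (R K : Type*) [CommRing R] [Field K] [Algebra R K] :=
  {s : SemistarOperation R K // s.IsStable}

/-- The partially ordered set of semistar operations `⋆` on `R` such that `R^⋆` is a valuation
domain (fields, in particular `K` itself, are valuation domains). -/
abbrev ValuationSemistar (R K : Type*) [CommRing R] [Field K] [Algebra R K] :=
  {s : SemistarOperation R K // ValuationRing s.overring}

/-- The nonempty up-closed sets of semistar operations `⋆` such that `R^⋆` is a valuation domain.
The order is that of `UpperSet`, which is reverse inclusion: `X ≤ Y` if and only if `Y ⊆ X`. -/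
abbrev UpClosedValuationSemistar (R K : Type*) [CommRing R] [Field K] [Algebra R K] :=
  {X : UpperSet (ValuationSemistar R K) // (X : Set (ValuationSemistar R K)).Nonempty}

/-- The infimum of such an up-closed set `X`, as a semistar operation. -/
def UpClosedValuationSemistar.inf {R K : Type*} [CommRing R] [Field K] [Algebra R K]
    (X : UpClosedValuationSemistar R K) : SemistarOperation R K :=
  SemistarOperation.infimum (Subtype.val '' (X.1 : Set (ValuationSemistar R K)))
    (X.2.image Subtype.val)

/-! By homogeneity, `⋆` is determined by the `I` with `1 ∈ I^⋆` (`le_of_one_mem`).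

Well-definedness: if `V = R^⋆` is a valuation ring, then `I^⋆ = (IV)^⋆`. The modules `IV` form a
chain, and `I ↦ IV` preserves finite intersections because `V` is a localization of `R`. So `⋆` is
stable (`isStable_of_valuationRing`), and stability passes to infima.

Surjectivity: for stable `⋆`, take all valuation operations above it. These include `I ↦ (I R_P)^⋆`
for every prime `P`, so the point is to recover `1 ∈ I^⋆` from `1 ∈ (I R_P)^⋆` for all `P`.
Finiteness of the minimal primes of `I ∩ R` lets stability handle the intersection over them
(`IsStable.one_mem_star_of_localizeAt`).

Order reflection: an operation `t` above `inf X` must lie above a member of `X`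
(`exists_le_of_infimum_le`). A single ideal of `R` detects this: the center of `R^t` if the maximal
ideal `M` of `R^t` satisfies `1 ∉ M^t`, and otherwise a finitely generated ideal with the center as
radical, which a Noetherian spectrum supplies. -/

/-! ### Prüfer divisibility and Noetherian spectra -/

/-- Elementwise form of the Prüfer condition: at each prime, `e` or `1 - e` is a unit, so `a`
divides `b` or `b` divides `a` locally. -/
theorem IsPruferDomain.exists_mul_eq_mul {R : Type*} [CommRing R] [IsDomain R]
    (hR : IsPruferDomain R) (a b : R) :
    ∃ e f g : R, e * b = f * a ∧ (1 - e) * a = g * b := by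
  by_cases hab : Ideal.span {a, b} = ⊥
  · have ha : a = 0 := by
      have : a ∈ Ideal.span {a, b} := Ideal.subset_span (by simp)
      simpa [hab] using this
    have hb : b = 0 := by
      have : b ∈ Ideal.span {a, b} := Ideal.subset_span (by simp)
      simpa [hab] using this
    exact ⟨0, 0, 0, by simp [ha, hb]⟩
  · obtain ⟨J, hJ⟩ := (hR _ (Submodule.fg_span (by simp)) hab).exists_right_inv
    have hmul : ∀ c ∈ Ideal.span {a, b}, ∀ j ∈ J,
        ∃ r : R, algebraMap R (FractionRing R) r = algebraMap R (FractionRing R) c * j := by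
      intro c hc j hj
      rw [← FractionalIdeal.mem_one_iff R⁰, ← hJ]
      exact FractionalIdeal.mul_mem_mul (FractionalIdeal.mem_coeIdeal_of_mem _ hc) hj
    have ha : a ∈ Ideal.span {a, b} := Ideal.subset_span (by simp)
    have hb : b ∈ Ideal.span {a, b} := Ideal.subset_span (by simp)
    have h1 : (1 : FractionRing R) ∈ (1 : FractionalIdeal R⁰ (FractionRing R)) :=
      FractionalIdeal.one_mem_one R⁰
    rw [← hJ, ← Ideal.span, Ideal.span_insert, FractionalIdeal.coeIdeal_sup,
      FractionalIdeal.coeIdeal_span_singleton, FractionalIdeal.coeIdeal_span_singleton,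
      add_mul, FractionalIdeal.mem_add] at h1
    obtain ⟨x, hx, y, hy, hxy⟩ := h1
    obtain ⟨c, hc, rfl⟩ := FractionalIdeal.mem_singleton_mul.mp hx
    obtain ⟨d, hd, rfl⟩ := FractionalIdeal.mem_singleton_mul.mp hy
    obtain ⟨e, he⟩ := hmul a ha c hc
    obtain ⟨f, hf⟩ := hmul b hb c hc
    -- Here `1 = ac + bd` with `c`, `d` in the inverse ideal, and `e = ac`, `f = bc`, `g = ad`.
    obtain ⟨g, hg⟩ := hmul a ha d hd
    refine ⟨e, f, g, ?_, ?_⟩ <;> apply IsFractionRing.injective R (FractionRing R)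
    · rw [map_mul, map_mul, he, hf]; ring
    · rw [map_mul, map_mul, map_sub, map_one, he, hg, ← hxy]; ring

theorem Ideal.finite_minimalPrimes_of_noetherianSpace {R : Type*} [CommRing R]
    [TopologicalSpace.NoetherianSpace (PrimeSpectrum R)] (I : Ideal R) :
    I.minimalPrimes.Finite := by
  have h := TopologicalSpace.NoetherianSpace.finite_irreducibleComponents
    (α := PrimeSpectrum.zeroLocus (I : Set R))
  have : Finite (irreducibleComponents (PrimeSpectrum.zeroLocus (I : Set R))) := h
  exact Finite.of_equiv (irreducibleComponents (PrimeSpectrum.zeroLocus (I : Set R)))ᵒᵈ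
    (Ideal.minimalPrimes.equivIrreducibleComponents I).symm.toEquiv

/-- The complement of `V(I)` is a quasi-compact open set, hence is cut out by finitely many
elements. -/
theorem Ideal.exists_fg_radical_eq {R : Type*} [CommRing R]
    [TopologicalSpace.NoetherianSpace (PrimeSpectrum R)] (I : Ideal R) :
    ∃ J : Ideal R, J.FG ∧ J.radical = I.radical := by
  obtain ⟨J, hJ, h⟩ := PrimeSpectrum.isCompact_isOpen_iff_ideal.mp
    ⟨TopologicalSpace.NoetherianSpace.isCompact (PrimeSpectrum.zeroLocus (I : Set R))ᶜ,
      (PrimeSpectrum.isClosed_zeroLocus _).isOpen_compl⟩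
  refine ⟨J, hJ, ?_⟩
  rw [← PrimeSpectrum.vanishingIdeal_zeroLocus_eq_radical,
    ← PrimeSpectrum.vanishingIdeal_zeroLocus_eq_radical, compl_injective h]

theorem Submodule.mem_pointwise_smul_iff {R K : Type*} [CommRing R] [Field K] [Algebra R K]
    {x : K} (hx : x ≠ 0) (N : Submodule R K) (y : K) : y ∈ x • N ↔ x⁻¹ * y ∈ N := by
  rw [Submodule.mem_smul_pointwise_iff_exists]
  constructor
  · rintro ⟨z, hz, rfl⟩
    simpa [smul_eq_mul, hx] using hz
  · intro h
    exact ⟨_, h, by simp [smul_eq_mul, hx]⟩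

/-! ### General properties of semistar operations -/

namespace SemistarOperation

variable {R K : Type*} [CommRing R] [Field K] [Algebra R K]

theorem algebraMap_mem_star_one (s : SemistarOperation R K) (r : R) :
    algebraMap R K r ∈ s.star 1 :=
  s.le_star 1 (Submodule.mem_one.mpr ⟨r, rfl⟩)

theorem one_mem_star_one (s : SemistarOperation R K) : (1 : K) ∈ s.star 1 := by
  simpa using s.algebraMap_mem_star_one 1

theorem mem_star_iff (s : SemistarOperation R K) {x : K} (hx : x ≠ 0) (I : Submodule R K) :
    x ∈ s.star I ↔ 1 ∈ s.star (x⁻¹ • I) := by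
  rw [star_smul, Submodule.mem_pointwise_smul_iff (inv_ne_zero hx), inv_inv, mul_one]

theorem le_of_one_mem {s t : SemistarOperation R K}
    (h : ∀ I, 1 ∈ s.star I → 1 ∈ t.star I) : s ≤ t := by
  intro I x hxI
  rcases eq_or_ne x 0 with rfl | hx
  · exact zero_mem _
  · rw [mem_star_iff _ hx] at hxI ⊢
    exact h _ hxI

/-- If `x` times every element of `N` lies in `I`, then `x • N^⋆ ⊆ I^⋆`. -/
theorem mul_mem_star_of_forall (s : SemistarOperation R K) {N I : Submodule R K} {x y : K}
    (h : ∀ z ∈ N, x * z ∈ I) (hy : y ∈ s.star N) : x * y ∈ s.star I := by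
  have h1 : x • N ≤ I := by
    intro w hw
    obtain ⟨z, hz, rfl⟩ := Submodule.mem_smul_pointwise_iff_exists _ _ _ |>.mp hw
    exact h z hz
  have h2 := s.star_mono _ _ h1
  rw [s.star_smul] at h2
  exact h2 (Submodule.smul_mem_pointwise_smul y x _ hy)

theorem mul_mem_star (s : SemistarOperation R K) {I : Submodule R K} {a y : K}
    (ha : a ∈ s.star 1) (hy : y ∈ s.star I) : a * y ∈ s.star I := by
  rw [mul_comm, ← s.star_star I]
  refine s.mul_mem_star_of_forall (fun z hz => ?_) ha
  obtain ⟨r, rfl⟩ := Submodule.mem_one.mp hz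
  rw [mul_comm, ← Algebra.smul_def]
  exact Submodule.smul_mem _ r hy

/-- The extension of `I` to the overring `R^⋆` has the same closure as `I`. -/
theorem star_mul_star_one (s : SemistarOperation R K) (I : Submodule R K) :
    s.star (I * s.star 1) = s.star I := by
  apply le_antisymm
  · rw [← s.star_star I]
    apply s.star_mono
    rw [Submodule.mul_le]
    intro i hi v hv
    rw [mul_comm]
    exact s.mul_mem_star hv (s.le_star I hi)
  · apply s.star_mono
    intro i hi
    rw [← mul_one i]
    exact Submodule.mul_mem_mul hi s.one_mem_star_one

/-- `R^⋆` is a valuation ring if it contains `x` or `x⁻¹` for every `x`. -/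
theorem valuationRing_of_mem_or_inv_mem {s : SemistarOperation R K}
    (h : ∀ x : K, x ∈ s.star 1 ∨ x⁻¹ ∈ s.star 1) : ValuationRing s.overring where
  cond' := by
    rintro ⟨a, ha⟩ ⟨b, hb⟩
    rcases eq_or_ne a 0 with rfl | ha0
    · exact ⟨0, Or.inr (by ext; simp)⟩
    rcases eq_or_ne b 0 with rfl | hb0
    · exact ⟨0, Or.inl (by ext; simp)⟩
    rcases h (b / a) with hc | hc
    · exact ⟨⟨_, hc⟩, Or.inl (by ext; simp; field_simp)⟩
    · exact ⟨⟨_, hc⟩, Or.inr (by ext; simp; field_simp)⟩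

/-! ### Valuation overrings and stability -/

section Valuation

variable [IsDomain R] [IsFractionRing R K] {s : SemistarOperation R K}

theorem mem_or_inv_mem (hs : ValuationRing s.overring) (x : K) :
    x ∈ s.star 1 ∨ x⁻¹ ∈ s.star 1 := by
  obtain ⟨a, b, hb, rfl⟩ := IsFractionRing.div_surjective (A := R) x
  have hb0 : algebraMap R K b ≠ 0 := IsFractionRing.to_map_ne_zero_of_mem_nonZeroDivisors hb
  rcases eq_or_ne (algebraMap R K a) 0 with ha0 | ha0
  · left; simp [ha0]
  obtain ⟨⟨c, hc⟩, h | h⟩ := hs.cond' ⟨_, s.algebraMap_mem_star_one a⟩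
    ⟨_, s.algebraMap_mem_star_one b⟩
  · right
    have h' : algebraMap R K a * c = algebraMap R K b := congrArg Subtype.val h
    rw [inv_div, ← h', mul_div_cancel_left₀ _ ha0]
    exact hc
  · left
    have h' : algebraMap R K b * c = algebraMap R K a := congrArg Subtype.val h
    rw [← h', mul_div_cancel_left₀ _ hb0]
    exact hc

/-- Every element of a valuation overring `R^⋆` of a Prüfer domain is a fraction whose
denominator is a unit of `R^⋆`. -/
theorem exists_algebraMap_mul_eq (hR : IsPruferDomain R) (hs : ValuationRing s.overring) {v : K}
    (hv : v ∈ s.star 1) :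
    ∃ a b : R, b ≠ 0 ∧ (algebraMap R K b)⁻¹ ∈ s.star 1 ∧
      algebraMap R K b * v = algebraMap R K a := by
  obtain ⟨a, b, hb, rfl⟩ := IsFractionRing.div_surjective (A := R) v
  have hb0 : algebraMap R K b ≠ 0 := IsFractionRing.to_map_ne_zero_of_mem_nonZeroDivisors hb
  obtain ⟨e, f, g, hef, heg⟩ := hR.exists_mul_eq_mul a b
  have hef' := congrArg (algebraMap R K) hef
  have heg' := congrArg (algebraMap R K) heg
  rw [map_mul, map_mul] at hef' heg'
  have key : ∀ u c : R, (algebraMap R K u) ≠ 0 → (algebraMap R K u)⁻¹ ∈ s.star 1 →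
      algebraMap R K u * algebraMap R K a = algebraMap R K c * algebraMap R K b →
      ∃ a' b' : R, b' ≠ 0 ∧ (algebraMap R K b')⁻¹ ∈ s.star 1 ∧
      algebraMap R K b' * (algebraMap R K a / algebraMap R K b) = algebraMap R K a' := by
    intro u c hu hu' h
    refine ⟨c, u, fun h0 => hu (by rw [h0, map_zero]), hu', ?_⟩
    rw [← mul_div_assoc, h, mul_div_cancel_right₀ _ hb0]
  have hsum : algebraMap R K e + algebraMap R K (1 - e) = 1 := by
    rw [← map_add]; simp
  -- Two elements of a valuation ring with sum `1` cannot both be non-units. If `1 - e` is a unit,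
  -- then `v = g / (1 - e)`; if `e` is, then `v = e / f` and `f⁻¹ = e⁻¹ v`.
  have hunit : (algebraMap R K (1 - e) ≠ 0 ∧ (algebraMap R K (1 - e))⁻¹ ∈ s.star 1) ∨
      (algebraMap R K e ≠ 0 ∧ (algebraMap R K e)⁻¹ ∈ s.star 1) := by
    rcases eq_or_ne (algebraMap R K e) 0 with h0 | h0
    · left
      rw [h0, zero_add] at hsum
      simpa [hsum] using s.one_mem_star_one
    rcases eq_or_ne (algebraMap R K (1 - e)) 0 with h1 | h1
    · right
      rw [h1, add_zero] at hsum
      simpa [hsum] using s.one_mem_star_one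
    rcases mem_or_inv_mem hs (algebraMap R K e / algebraMap R K (1 - e)) with h | h
    · left
      refine ⟨h1, ?_⟩
      convert add_mem h s.one_mem_star_one using 1
      field_simp
      exact hsum.symm
    · right
      refine ⟨h0, ?_⟩
      convert add_mem h s.one_mem_star_one using 1
      field_simp
      rw [add_comm, hsum]
  rcases hunit with ⟨h0, h1⟩ | ⟨h0, h1⟩
  · exact key _ _ h0 h1 heg'
  · rcases eq_or_ne f 0 with rfl | hf
    · rw [map_zero, zero_mul] at hef'
      exact absurd hef' (mul_ne_zero h0 hb0)
    have hf0 : algebraMap R K f ≠ 0 := by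
      simpa using hf
    refine ⟨e, f, hf, ?_, ?_⟩
    · have ha0 : algebraMap R K a ≠ 0 := by
        rintro h
        rw [h, mul_zero] at hef'
        exact mul_ne_zero h0 hb0 hef'
      convert s.mul_mem_star_one h1 hv using 1
      field_simp
      linear_combination hef'
    · rw [← mul_div_assoc, ← hef', mul_div_cancel_right₀ _ hb0]

/-- Of two elements of `I`, one divides the other over `R^⋆`, so sums of products collapse to one
product. -/
theorem exists_eq_mul_of_mem_mul (hs : ValuationRing s.overring) {I : Submodule R K} {x : K}
    (hx : x ∈ I * s.star 1) : ∃ i ∈ I, ∃ v ∈ s.star 1, x = i * v := by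
  induction hx using Submodule.mul_induction_on' with
  | mem_mul_mem i hi v hv => exact ⟨i, hi, v, hv, rfl⟩
  | add x _ y _ hx hy =>
    obtain ⟨i, hi, v, hv, rfl⟩ := hx
    obtain ⟨j, hj, w, hw, rfl⟩ := hy
    rcases eq_or_ne i 0 with rfl | hi0
    · exact ⟨j, hj, w, hw, by simp⟩
    rcases eq_or_ne j 0 with rfl | hj0
    · exact ⟨i, hi, v, hv, by simp⟩
    rcases mem_or_inv_mem hs (i / j) with h | h
    · exact ⟨j, hj, _, add_mem (s.mul_mem_star_one h hv) hw, by field_simp⟩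
    · exact ⟨i, hi, _, add_mem hv (s.mul_mem_star_one h hw), by field_simp⟩

/-- Clearing denominators, which are units of `R^⋆`, moves a common element into `I ∩ J`. -/
theorem mul_star_one_inf_le (hR : IsPruferDomain R) (hs : ValuationRing s.overring)
    (I J : Submodule R K) :
    I * s.star 1 ⊓ J * s.star 1 ≤ (I ⊓ J) * s.star 1 := by
  rintro x ⟨hI, hJ⟩
  obtain ⟨i, hi, v, hv, rfl⟩ := exists_eq_mul_of_mem_mul hs hI
  obtain ⟨j, hj, w, hw, hij⟩ := exists_eq_mul_of_mem_mul hs hJ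
  obtain ⟨a, b, hb, hb', hv'⟩ := exists_algebraMap_mul_eq hR hs hv
  obtain ⟨c, d, hd, hd', hw'⟩ := exists_algebraMap_mul_eq hR hs hw
  have hb0 : algebraMap R K b ≠ 0 := by simpa using hb
  have hd0 : algebraMap R K d ≠ 0 := by simpa using hd
  have hmem : algebraMap R K (d * b) * (i * v) ∈ I ⊓ J := by
    constructor
    · have : algebraMap R K (d * b) * (i * v) = (d * a) • i := by
        rw [Algebra.smul_def, map_mul, map_mul, ← hv']; ring
      rw [this]
      exact I.smul_mem _ hi
    · have : algebraMap R K (d * b) * (i * v) = (b * c) • j := by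
        rw [hij, Algebra.smul_def, map_mul, map_mul, ← hw']; ring
      rw [this]
      exact J.smul_mem _ hj
  convert Submodule.mul_mem_mul hmem (s.mul_mem_star_one hd' hb') using 1
  rw [map_mul]
  field_simp

theorem mul_star_one_total (hs : ValuationRing s.overring) (I J : Submodule R K) :
    I * s.star 1 ≤ J * s.star 1 ∨ J * s.star 1 ≤ I * s.star 1 := by
  by_contra! h
  obtain ⟨h1, h2⟩ := h
  obtain ⟨x, hxI, hxJ⟩ := SetLike.not_le_iff_exists.mp h1
  obtain ⟨y, hyJ, hyI⟩ := SetLike.not_le_iff_exists.mp h2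
  have hx0 : x ≠ 0 := by rintro rfl; exact hxJ (zero_mem _)
  have hy0 : y ≠ 0 := by rintro rfl; exact hyI (zero_mem _)
  obtain ⟨i, hi, v, hv, rfl⟩ := exists_eq_mul_of_mem_mul hs hxI
  obtain ⟨j, hj, w, hw, rfl⟩ := exists_eq_mul_of_mem_mul hs hyJ
  rcases mem_or_inv_mem hs (i * v / (j * w)) with h | h
  · apply hxJ
    convert Submodule.mul_mem_mul hj (s.mul_mem_star_one hw h) using 1
    rw [← mul_assoc, mul_div_cancel₀ _ hy0]
  · apply hyI
    convert Submodule.mul_mem_mul hi (s.mul_mem_star_one hv h) using 1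
    rw [inv_div, ← mul_assoc, mul_div_cancel₀ _ hx0]

theorem isStable_of_valuationRing (hR : IsPruferDomain R) (hs : ValuationRing s.overring) :
    s.IsStable := by
  intro I J
  refine le_antisymm (le_inf (s.star_mono _ _ inf_le_left) (s.star_mono _ _ inf_le_right)) ?_
  rw [← s.star_mul_star_one (I ⊓ J), ← s.star_mul_star_one I, ← s.star_mul_star_one J]
  refine le_trans ?_ (s.star_mono _ _ (mul_star_one_inf_le hR hs I J))
  rcases mul_star_one_total hs I J with h | h
  · rw [inf_eq_left.mpr h]; exact inf_le_left
  · rw [inf_eq_right.mpr h]; exact inf_le_right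

end Valuation

theorem isStable_infimum {X : Set (SemistarOperation R K)} (hX : X.Nonempty)
    (h : ∀ s ∈ X, s.IsStable) : (infimum X hX).IsStable := by
  intro I J
  ext x
  simp only [infimum, Submodule.mem_iInf, Submodule.mem_inf]
  constructor
  · intro hx
    exact ⟨fun s hs => ((h s hs I J).le (hx s hs)).1, fun s hs => ((h s hs I J).le (hx s hs)).2⟩
  · rintro ⟨h1, h2⟩ s hs
    exact (h s hs I J).ge ⟨h1 s hs, h2 s hs⟩

end SemistarOperation

/-! ### Localization at primes and recovery of stable operations -/

namespace SemistarOperation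

variable {R K : Type*} [CommRing R] [Field K] [Algebra R K]

/-- The localization `I R_P`, as an `R`-submodule of `K`. -/
def localizeAt (P : Ideal R) [P.IsPrime] (I : Submodule R K) : Submodule R K where
  carrier := {x | ∃ u ∉ P, u • x ∈ I}
  add_mem' := by
    rintro x y ⟨u, hu, hx⟩ ⟨v, hv, hy⟩
    refine ⟨u * v, fun h => (Ideal.IsPrime.mem_or_mem ‹_› h).elim hu hv, ?_⟩
    rw [smul_add]
    refine add_mem ?_ ?_
    · rw [mul_comm, mul_smul]
      exact I.smul_mem _ hx
    · rw [mul_smul]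
      exact I.smul_mem _ hy
  zero_mem' := ⟨1, fun h => Ideal.IsPrime.ne_top ‹_› ((Ideal.eq_top_iff_one _).mpr h), by simp⟩
  smul_mem' := by
    rintro r x ⟨u, hu, hx⟩
    refine ⟨u, hu, ?_⟩
    rw [smul_comm]
    exact I.smul_mem _ hx

theorem mem_localizeAt {P : Ideal R} [P.IsPrime] {I : Submodule R K} {x : K} :
    x ∈ localizeAt P I ↔ ∃ u ∉ P, u • x ∈ I :=
  Iff.rfl

theorem le_localizeAt (P : Ideal R) [P.IsPrime] (I : Submodule R K) : I ≤ localizeAt P I :=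
  fun x hx => ⟨1, fun h => Ideal.IsPrime.ne_top ‹_› ((Ideal.eq_top_iff_one _).mpr h), by simpa⟩

theorem localizeAt_mono (P : Ideal R) [P.IsPrime] {I J : Submodule R K} (h : I ≤ J) :
    localizeAt P I ≤ localizeAt P J :=
  fun _ ⟨u, hu, hx⟩ => ⟨u, hu, h hx⟩

theorem localizeAt_bot (P : Ideal R) [P.IsPrime] [IsDomain R] [IsFractionRing R K] :
    localizeAt P (⊥ : Submodule R K) = ⊥ := by
  rw [eq_bot_iff]
  rintro x ⟨u, hu, hx⟩
  rw [Submodule.mem_bot, Algebra.smul_def, mul_eq_zero] at hx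
  rcases hx with h | h
  · have : u = 0 := by simpa using h
    exact absurd (this ▸ zero_mem P) hu
  · exact h

theorem localizeAt_smul {x : K} (hx : x ≠ 0) (P : Ideal R) [P.IsPrime] (I : Submodule R K) :
    localizeAt P (x • I) = x • localizeAt P I := by
  ext y
  simp only [Submodule.mem_pointwise_smul_iff hx, mem_localizeAt, mul_smul_comm]

/-- The semistar operation `I ↦ (I R_P)^⋆`. -/
def localization [IsDomain R] [IsFractionRing R K] (s : SemistarOperation R K) (P : Ideal R)
    [P.IsPrime] : SemistarOperation R K where
  star I := s.star (localizeAt P I)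
  le_star I := (le_localizeAt P I).trans (s.le_star _)
  star_star I := by
    refine le_antisymm ?_ ((le_localizeAt P _).trans (s.le_star _))
    rw [← s.star_star (localizeAt P I)]
    apply s.star_mono
    rw [s.star_star]
    rintro x ⟨u, hu, hx⟩
    have hu0 : algebraMap R K u ≠ 0 := by
      intro h
      have : u = 0 := by simpa using h
      exact hu (this ▸ zero_mem P)
    rw [Algebra.smul_def] at hx
    -- Division by `u ∉ P` preserves `I R_P`, hence also its closure.
    have h := s.mul_mem_star_of_forall (I := localizeAt P I)
      (x := (algebraMap R K u)⁻¹) ?_ hx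
    · rwa [inv_mul_cancel_left₀ hu0] at h
    · rintro z ⟨v, hv, hz⟩
      refine ⟨v * u, fun h => (Ideal.IsPrime.mem_or_mem ‹_› h).elim hv hu, ?_⟩
      rwa [mul_smul, Algebra.smul_def u, mul_inv_cancel_left₀ hu0]
  star_mono I J h := s.star_mono _ _ (localizeAt_mono P h)
  star_smul x I := by
    rcases eq_or_ne x 0 with rfl | hx
    · rw [zero_smul, zero_smul, Submodule.zero_eq_bot, localizeAt_bot, s.star_bot]
    · rw [localizeAt_smul hx, s.star_smul]

theorem le_localization [IsDomain R] [IsFractionRing R K] (s : SemistarOperation R K)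
    (P : Ideal R) [P.IsPrime] : s ≤ s.localization P :=
  fun I => s.star_mono _ _ (le_localizeAt P I)

theorem valuationRing_localization [IsDomain R] [IsFractionRing R K] (hR : IsPruferDomain R)
    (s : SemistarOperation R K) (P : Ideal R) [P.IsPrime] :
    ValuationRing (s.localization P).overring := by
  apply valuationRing_of_mem_or_inv_mem
  intro x
  obtain ⟨a, b, hb, rfl⟩ := IsFractionRing.div_surjective (A := R) x
  have hb0 : algebraMap R K b ≠ 0 := IsFractionRing.to_map_ne_zero_of_mem_nonZeroDivisors hb
  rcases eq_or_ne (algebraMap R K a) 0 with ha0 | ha0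
  · left; simp [ha0]
  obtain ⟨e, f, g, hef, heg⟩ := hR.exists_mul_eq_mul a b
  have hef' := congrArg (algebraMap R K) hef
  have heg' := congrArg (algebraMap R K) heg
  rw [map_mul, map_mul] at hef' heg'
  by_cases he : e ∈ P
  · left
    refine s.le_star _ ⟨1 - e, fun h => ?_, Submodule.mem_one.mpr ⟨g, ?_⟩⟩
    · apply Ideal.IsPrime.ne_top ‹P.IsPrime›
      rw [Ideal.eq_top_iff_one]
      simpa using add_mem h he
    · rw [Algebra.smul_def, ← mul_div_assoc, heg', mul_div_cancel_right₀ _ hb0]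
  · right
    refine s.le_star _ ⟨e, he, Submodule.mem_one.mpr ⟨f, ?_⟩⟩
    rw [Algebra.smul_def, inv_div, ← mul_div_assoc, hef', mul_div_cancel_right₀ _ ha0]

theorem IsStable.mem_star_iInf {s : SemistarOperation R K} (hs : s.IsStable) {ι : Type*}
    {F : Set ι} (hF : F.Finite) {N : ι → Submodule R K} {x : K} (hx : x ∈ s.star ⊤)
    (h : ∀ i ∈ F, x ∈ s.star (N i)) : x ∈ s.star (⨅ i ∈ F, N i) := by
  induction F, hF using Set.Finite.induction_on with
  -- The empty intersection is `⊤`, which is why `x ∈ s.star ⊤` is assumed.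
  | empty => simpa using hx
  | @insert a F _ _ ih =>
    rw [iInf_insert, hs]
    exact ⟨h a (Set.mem_insert _ _), ih fun i hi => h i (Set.mem_insert_of_mem _ hi)⟩

/-- A stable semistar operation on a Prüfer domain is determined by its localizations at the
minimal primes of ideals that have only finitely many of them. -/
theorem IsStable.one_mem_star_of_localizeAt [IsDomain R] [IsFractionRing R K]
    (hR : IsPruferDomain R) {s : SemistarOperation R K} (hs : s.IsStable) (I : Submodule R K)
    (hfin : (Ideal.minimalPrimes (I.comap (Algebra.linearMap R K))).Finite)
    (h : ∀ (P : Ideal R) [P.IsPrime], 1 ∈ s.star (localizeAt P I)) : 1 ∈ s.star I := by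
  set J : Ideal R := I.comap (Algebra.linearMap R K)
  have htop : (1 : K) ∈ s.star ⊤ := s.le_star _ trivial
  have hloc : ∀ P ∈ J.minimalPrimes,
      1 ∈ s.star ((⨅ _ : P.IsPrime, localizeAt P I) ⊓ 1) := by
    intro P hP
    have := hP.1.1
    rw [hs, iInf_pos this]
    exact ⟨h P, s.one_mem_star_one⟩
  -- Let `L` be the intersection of the `I R_P ∩ R` and `N` that of the `P`, over the minimal primes
  -- `P` of `J`. Stability gives `1 ∈ L^⋆` and `1 ∈ N^⋆`; since `LN ⊆ I`, this yields `1 ∈ I^⋆`.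
  have hL := hs.mem_star_iInf hfin htop hloc
  have hN := hs.mem_star_iInf (N := fun P : Ideal R => Submodule.map (Algebra.linearMap R K) P) hfin htop
    (by
      intro P hP
      have hPp := hP.1.1
      refine s.star_mono _ _ ?_ (hloc P hP)
      rw [iInf_pos hPp]
      rintro x ⟨⟨u, hu, hx⟩, hx1⟩
      obtain ⟨r, rfl⟩ := Submodule.mem_one.mp hx1
      refine ⟨r, ?_, rfl⟩
      have : u * r ∈ J := by
        change algebraMap R K (u * r) ∈ I
        rwa [map_mul, ← Algebra.smul_def]
      exact (hPp.mem_or_mem (hP.1.2 this)).resolve_left hu)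
  rcases J.minimalPrimes.eq_empty_or_nonempty with hemp | ⟨P₀, hP₀⟩
  · rw [Ideal.minimalPrimes_eq_empty_iff] at hemp
    apply s.le_star
    have h1 : (1 : R) ∈ J := hemp ▸ trivial
    have h2 : algebraMap R K 1 ∈ I := h1
    rwa [map_one] at h2
  rw [← s.star_star I]
  refine s.star_mono _ _ ?_ hL
  intro x hx
  rw [← mul_one x]
  refine s.mul_mem_star_of_forall (fun y hy => ?_) hN
  simp only [Submodule.mem_iInf] at hx hy
  obtain ⟨x, rfl⟩ := Submodule.mem_one.mp (hx P₀ hP₀).2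
  obtain ⟨y, -, rfl⟩ := hy P₀ hP₀
  have hx' : ∀ P ∈ J.minimalPrimes, ∃ u ∉ P, u * x ∈ J := by
    intro P hP
    have h1 : algebraMap R K x ∈ ⨅ _ : P.IsPrime, localizeAt P I := (hx P hP).1
    rw [iInf_pos hP.1.1] at h1
    obtain ⟨u, hu, h⟩ := h1
    refine ⟨u, hu, ?_⟩
    change algebraMap R K (u * x) ∈ I
    rwa [map_mul, ← Algebra.smul_def]
  have hy' : ∀ P ∈ J.minimalPrimes, y ∈ P := by
    intro P hP
    obtain ⟨z, hz, hzy⟩ := hy P hP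
    rwa [← IsFractionRing.injective R K hzy]
  -- `LN ⊆ J` is checked at each maximal ideal `M`. With `P ⊆ M` minimal over `J`, `y ∈ P` and `u ∉
  -- P`, the element `u` divides `y` in the valuation ring `R_M`; since `ux ∈ J`, it follows that
  -- `xy ∈ J R_M`.
  have key : Submodule.colon J {x * y} = ⊤ := by
    by_contra hne
    obtain ⟨M, hM, hle⟩ := Ideal.exists_le_maximal _ hne
    have hJM : J ≤ M := fun r hr => hle (Submodule.mem_colon_singleton.mpr (J.mul_mem_right _ hr))
    obtain ⟨P, hP, hPM⟩ := Ideal.exists_minimalPrimes_le hJM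
    have hPp := hP.1.1
    obtain ⟨u, hu, hux⟩ := hx' P hP
    obtain ⟨e, f, g, hef, heg⟩ := hR.exists_mul_eq_mul y u
    have heP : e ∈ P := by
      have : e * u ∈ P := hef ▸ P.mul_mem_left _ (hy' P hP)
      exact (hPp.mem_or_mem this).resolve_right hu
    have h1e : 1 - e ∈ Submodule.colon J {x * y} := by
      rw [Submodule.mem_colon_singleton, smul_eq_mul]
      have : (1 - e) * (x * y) = g * (u * x) := by linear_combination x * heg
      rw [this]
      exact J.mul_mem_left _ hux
    apply hM.ne_top
    rw [Ideal.eq_top_iff_one]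
    simpa using add_mem (hle h1e) (hPM heP)
  have : (1 : R) ∈ Submodule.colon J {x * y} := key ▸ trivial
  rw [Submodule.mem_colon_singleton, one_smul] at this
  have h2 : algebraMap R K (x * y) ∈ I := this
  rwa [map_mul] at h2

/-! ### Centers and comparison of valuation operations -/

section Valuation

variable [IsDomain R] [IsFractionRing R K] {s t : SemistarOperation R K}

/-- The maximal ideal of a valuation overring `R^⋆`, as an `R`-submodule of `K`. -/
def maximalSubmodule (hs : ValuationRing s.overring) : Submodule R K where
  carrier := {x | x = 0 ∨ x⁻¹ ∉ s.star 1}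
  zero_mem' := Or.inl rfl
  add_mem' := by
    intro x y hx hy
    rcases eq_or_ne x 0 with rfl | hx0
    · simpa using hy
    rcases eq_or_ne y 0 with rfl | hy0
    · simpa using hx
    have hx := hx.resolve_left hx0
    have hy := hy.resolve_left hy0
    by_cases hxy : x + y = 0
    · exact Or.inl hxy
    refine Or.inr fun h => ?_
    rcases mem_or_inv_mem hs (x / y) with h' | h'
    · apply hy
      convert s.mul_mem_star_one h (add_mem h' s.one_mem_star_one) using 1
      field_simp
    · apply hx
      convert s.mul_mem_star_one h (add_mem h' s.one_mem_star_one) using 1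
      field_simp
      ring
  smul_mem' := by
    intro r x hx
    rcases eq_or_ne (r • x) 0 with h0 | h0
    · exact Or.inl h0
    refine Or.inr fun h => ?_
    rw [Algebra.smul_def] at h h0
    have hr0 := left_ne_zero_of_mul h0
    have hx0 := right_ne_zero_of_mul h0
    apply hx.resolve_left hx0
    convert s.mul_mem_star_one (s.algebraMap_mem_star_one r) h using 1
    field_simp

theorem mem_maximalSubmodule {hs : ValuationRing s.overring} {x : K} :
    x ∈ maximalSubmodule hs ↔ x = 0 ∨ x⁻¹ ∉ s.star 1 :=
  Iff.rfl

/-- The center on `R` of a valuation overring `R^⋆`. -/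
def center (hs : ValuationRing s.overring) : Ideal R :=
  (maximalSubmodule hs).comap (Algebra.linearMap R K)

theorem notMem_center {hs : ValuationRing s.overring} {r : R} :
    r ∉ center hs ↔ algebraMap R K r ≠ 0 ∧ (algebraMap R K r)⁻¹ ∈ s.star 1 := by
  change ¬(algebraMap R K r = 0 ∨ (algebraMap R K r)⁻¹ ∉ s.star 1) ↔ _
  push Not
  rfl

theorem isPrime_center (hs : ValuationRing s.overring) : (center hs).IsPrime where
  ne_top' := by
    rw [Ideal.ne_top_iff_one, notMem_center]
    simpa using s.one_mem_star_one
  mem_or_mem' := by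
    intro x y hxy
    by_contra! h
    rw [notMem_center, notMem_center] at h
    refine notMem_center.mpr ?_ hxy
    rw [map_mul, mul_inv]
    exact ⟨mul_ne_zero h.1.1 h.2.1, s.mul_mem_star_one h.1.2 h.2.2⟩

/-- Each valuation overring is the localization of `R` at its center. -/
theorem star_one_le_of_center_le (hR : IsPruferDomain R) {hs : ValuationRing s.overring}
    {ht : ValuationRing t.overring} (h : center ht ≤ center hs) : s.star 1 ≤ t.star 1 := by
  intro v hv
  obtain ⟨a, b, hb, hb', hab⟩ := exists_algebraMap_mul_eq hR hs hv
  have hb0 : algebraMap R K b ≠ 0 := by simpa using hb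
  have hbt := notMem_center.mp fun hbt => notMem_center.mpr ⟨hb0, hb'⟩ (h hbt)
  have : v = algebraMap R K a * (algebraMap R K b)⁻¹ := by
    rw [← hab]; field_simp
  rw [this]
  exact t.mul_mem_star_one (t.algebraMap_mem_star_one a) hbt.2

theorem one_mem_star_map_of_not_le_center {hs : ValuationRing s.overring} {I : Ideal R}
    (h : ¬ I ≤ center hs) : 1 ∈ s.star (Submodule.map (Algebra.linearMap R K) I) := by
  obtain ⟨a, ha, has⟩ := SetLike.not_le_iff_exists.mp h
  rw [notMem_center] at has
  rw [← inv_mul_cancel₀ has.1]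
  exact s.mul_mem_star has.2 (s.le_star _ ⟨a, ha, rfl⟩)

/-- If `R^⋆₁` is a valuation ring contained in `R^⋆₂`, then `R^⋆₂` is closed under `⋆₁`. -/
theorem star_star_one_le (hs : ValuationRing s.overring)
    (h : s.star 1 ≤ t.star 1) : s.star (t.star 1) ≤ t.star 1 := by
  intro z hz
  by_contra hzt
  have hz0 : z ≠ 0 := by rintro rfl; exact hzt (zero_mem _)
  -- If `z ∉ R^t`, then `z⁻¹ R^t ⊆ R^s`. As `(R^t)^s` also contains `z²`, multiplying by `z⁻¹` puts
  -- `z` in `R^s ⊆ R^t`.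
  have hsub : ∀ v ∈ t.star 1, z⁻¹ * v ∈ s.star 1 := by
    intro v hv
    rcases eq_or_ne v 0 with rfl | hv0
    · simp
    refine (mem_or_inv_mem hs _).resolve_right fun hinv => hzt ?_
    convert t.mul_mem_star_one (h hinv) hv using 1
    field_simp
  have h1 : z⁻¹ * z ∈ s.star (s.star 1) := s.mul_mem_star_of_forall hsub hz
  have h2 : z * z ∈ s.star (t.star 1) := by
    rw [← s.star_star (t.star 1)]
    refine s.mul_mem_star_of_forall (N := t.star 1) (fun v hv => ?_) hz
    rw [mul_comm, ← s.star_star (t.star 1), s.star_star]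
    exact s.mul_mem_star_of_forall (fun w hw => t.mul_mem_star_one hv hw) hz
  have h3 : z⁻¹ * (z * z) ∈ s.star (s.star 1) := s.mul_mem_star_of_forall hsub h2
  rw [inv_mul_cancel_left₀ hz0, s.star_star] at h3
  exact hzt (h h3)

theorem le_maximalSubmodule {ht : ValuationRing t.overring} {I : Submodule R K}
    (h : 1 ∉ t.star I) : t.star I ≤ maximalSubmodule ht := by
  intro x hx
  rcases eq_or_ne x 0 with rfl | hx0
  · exact zero_mem _
  refine Or.inr fun hinv => h ?_
  rw [← inv_mul_cancel₀ hx0]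
  exact t.mul_mem_star hinv hx

/-- If the maximal ideal of the valuation overring `R^⋆₂` is not `⋆₂`-closed, then `⋆₂` is the
largest semistar operation for its overring. -/
theorem le_of_one_mem_star_maximalSubmodule (hs : ValuationRing s.overring)
    {ht : ValuationRing t.overring} (h : s.star 1 ≤ t.star 1)
    (h1 : 1 ∈ t.star (maximalSubmodule ht)) : s ≤ t := by
  refine le_of_one_mem fun I hI => ?_
  by_contra hIt
  -- Otherwise `1` would lie in `I^t`. Such a `y` gives `I ⊆ y R^t`, so `1 ∈ I^s ⊆ y R^t` would make
  -- the non-unit `y` invertible.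
  have hlt : ∃ y ∈ maximalSubmodule ht, y ∉ t.star I := by
    by_contra! hle
    apply hIt
    rw [← t.star_star I]
    exact t.star_mono _ _ hle h1
  obtain ⟨y, hy, hyI⟩ := hlt
  have hy0 : y ≠ 0 := by rintro rfl; exact hyI (zero_mem _)
  have hle : ∀ x ∈ I, y⁻¹ * x ∈ t.star 1 := by
    intro x hx
    rcases eq_or_ne x 0 with rfl | hx0
    · simp
    refine (mem_or_inv_mem ht _).resolve_right fun hinv => hyI ?_
    convert t.mul_mem_star hinv (t.le_star I hx) using 1
    field_simp
  have h2 := star_star_one_le hs h (s.mul_mem_star_of_forall hle hI)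
  rw [mul_one] at h2
  exact hy.resolve_left hy0 h2

/-- Stability allows `I` to be replaced by `I ∩ R`, and `1 ∉ I^t` forces `I ∩ R` into the center of
`R^t`. -/
theorem le_of_one_notMem_star_center (hst : s.IsStable) {ht : ValuationRing t.overring}
    (hs1 : 1 ∉ s.star (Submodule.map (Algebra.linearMap R K) (center ht))) :
    s ≤ t := by
  refine le_of_one_mem fun I hI => ?_
  by_contra hIt
  apply hs1
  have h1 : 1 ∈ s.star (I ⊓ 1) := by
    rw [hst]
    exact ⟨hI, s.one_mem_star_one⟩
  refine s.star_mono _ _ ?_ h1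
  rintro x ⟨hx, hx1⟩
  obtain ⟨r, rfl⟩ := Submodule.mem_one.mp hx1
  exact ⟨r, le_maximalSubmodule (ht := ht) hIt (t.le_star I hx), rfl⟩

theorem exists_mem_of_fg (ht : ValuationRing t.overring) {I : Ideal R} (hI : I.FG) :
    ∃ i ∈ I, ∀ x ∈ I, ∃ v ∈ t.star 1, algebraMap R K x = algebraMap R K i * v := by
  induction I, hI using Submodule.fg_induction with
  | singleton a =>
    refine ⟨a, Submodule.mem_span_singleton_self a, fun x hx => ?_⟩
    obtain ⟨r, rfl⟩ := Submodule.mem_span_singleton.mp hx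
    exact ⟨_, t.algebraMap_mem_star_one r, by rw [smul_eq_mul, map_mul, mul_comm]⟩
  | sup I J _ _ hI hJ =>
    obtain ⟨i, hi, hi'⟩ := hI
    obtain ⟨j, hj, hj'⟩ := hJ
    have hdiv : (∃ v ∈ t.star 1, algebraMap R K j = algebraMap R K i * v) ∨
        (∃ v ∈ t.star 1, algebraMap R K i = algebraMap R K j * v) := by
      rcases eq_or_ne (algebraMap R K i) 0 with h0 | h0
      · exact Or.inr ⟨0, zero_mem _, by simp [h0]⟩
      rcases eq_or_ne (algebraMap R K j) 0 with h1 | h1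
      · exact Or.inl ⟨0, zero_mem _, by simp [h1]⟩
      rcases mem_or_inv_mem ht (algebraMap R K j / algebraMap R K i) with h | h
      · exact Or.inl ⟨_, h, by field_simp⟩
      · exact Or.inr ⟨_, h, by field_simp⟩
    rcases hdiv with ⟨w, hw, hjw⟩ | ⟨w, hw, hjw⟩
    · refine ⟨i, Ideal.mem_sup_left hi, fun x hx => ?_⟩
      obtain ⟨y, hy, z, hz, rfl⟩ := Submodule.mem_sup.mp hx
      obtain ⟨v, hv, h⟩ := hi' y hy
      obtain ⟨u, hu, h'⟩ := hj' z hz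
      refine ⟨v + w * u, add_mem hv (t.mul_mem_star_one hw hu), ?_⟩
      rw [map_add, h, h', hjw]; ring
    · refine ⟨j, Ideal.mem_sup_right hj, fun x hx => ?_⟩
      obtain ⟨y, hy, z, hz, rfl⟩ := Submodule.mem_sup.mp hx
      obtain ⟨v, hv, h⟩ := hi' y hy
      obtain ⟨u, hu, h'⟩ := hj' z hz
      refine ⟨w * v + u, add_mem (t.mul_mem_star_one hw hv) hu, ?_⟩
      rw [map_add, h, h', hjw]; ring

/-- Over `R^t` the ideal becomes principal, generated by some `i` in the center, and `i R^t` is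
already closed. -/
theorem one_notMem_star_map_of_fg {ht : ValuationRing t.overring} {I : Ideal R} (hI : I.FG)
    (h : I ≤ center ht) : 1 ∉ t.star (Submodule.map (Algebra.linearMap R K) I) := by
  intro h1
  obtain ⟨i, hi, hi'⟩ := exists_mem_of_fg (K := K) ht hI
  rcases eq_or_ne (algebraMap R K i) 0 with h0 | h0
  · have : Submodule.map (Algebra.linearMap R K) I = ⊥ := by
      rw [eq_bot_iff]
      rintro _ ⟨x, hx, rfl⟩
      obtain ⟨v, -, hv⟩ := hi' x hx
      change algebraMap R K x = 0
      rw [hv, h0, zero_mul]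
    rw [this, star_bot] at h1
    exact one_ne_zero h1
  · have h2 := t.mul_mem_star_of_forall (I := t.star 1) (x := (algebraMap R K i)⁻¹) ?_ h1
    · rw [mul_one, t.star_star] at h2
      exact notMem_center.mpr ⟨h0, h2⟩ (h hi)
    · rintro _ ⟨x, hx, rfl⟩
      obtain ⟨v, hv, hxv⟩ := hi' x hx
      change (algebraMap R K i)⁻¹ * algebraMap R K x ∈ _
      rwa [hxv, inv_mul_cancel_left₀ h0]

/-- If `Spec R` is Noetherian, a semistar operation with valuation overring that lies above the
infimum of a family of such operations lies above a member of the family. -/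
theorem exists_le_of_infimum_le (hR : IsPruferDomain R)
    [TopologicalSpace.NoetherianSpace (PrimeSpectrum R)] {X : Set (SemistarOperation R K)}
    (hX : X.Nonempty) (hval : ∀ s ∈ X, ValuationRing s.overring)
    (ht : ValuationRing t.overring) (h : infimum X hX ≤ t) : ∃ s ∈ X, s ≤ t := by
  have key : ∀ I : Submodule R K, 1 ∉ t.star I → ∃ s ∈ X, 1 ∉ s.star I := by
    intro I hI
    by_contra! hall
    exact hI (h I (by simpa only [infimum, Submodule.mem_iInf] using hall))
  have := isPrime_center ht
  -- If the closure contains `1`, then `t` is largest for its overring and `R^s ⊆ R^t` suffices.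
  -- Otherwise the center itself is the test ideal.
  by_cases h1 : 1 ∈ t.star (maximalSubmodule ht)
  · obtain ⟨I, hI, hrad⟩ := Ideal.exists_fg_radical_eq (center ht)
    rw [Ideal.IsPrime.radical this] at hrad
    obtain ⟨s, hs, hsI⟩ := key _ (one_notMem_star_map_of_fg (ht := ht) hI
      (hrad ▸ Ideal.le_radical))
    have := isPrime_center (hval s hs)
    have hle : I ≤ center (hval s hs) :=
      not_not.mp fun hn => hsI (one_mem_star_map_of_not_le_center hn)
    rw [← Ideal.IsPrime.radical_le_iff this, hrad] at hle
    exact ⟨s, hs, le_of_one_mem_star_maximalSubmodule (hval s hs)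
      (star_one_le_of_center_le hR hle) h1⟩
  · have h2 : 1 ∉ t.star (Submodule.map (Algebra.linearMap R K) (center ht)) := by
      refine fun h2 => h1 (t.star_mono _ _ ?_ h2)
      exact Submodule.map_comap_le _ _
    obtain ⟨s, hs, hsI⟩ := key _ h2
    exact ⟨s, hs, le_of_one_notMem_star_center (isStable_of_valuationRing hR (hval s hs))
      hsI⟩

end Valuation

/-! ### The correspondence with up-closed sets -/

/-- The valuation semistar operations above a stable one have it as infimum. -/
theorem IsStable.infimum_eq [IsDomain R] [IsFractionRing R K] (hR : IsPruferDomain R)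
    (hfin : ∀ I : Ideal R, I ≠ ⊤ → I.minimalPrimes.Finite) {s : SemistarOperation R K}
    (hs : s.IsStable) {X : Set (SemistarOperation R K)} (hX : X.Nonempty)
    (h : ∀ t, t ∈ X ↔ ValuationRing t.overring ∧ s ≤ t) : infimum X hX = s := by
  apply le_antisymm
  · refine le_of_one_mem fun I hI => hs.one_mem_star_of_localizeAt hR I ?_ fun P _ => ?_
    · by_cases htop : (I.comap (Algebra.linearMap R K) : Ideal R) = ⊤
      · rw [htop, Ideal.minimalPrimes_top]
        exact Set.finite_empty
      · exact hfin _ htop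
    · simp only [infimum, Submodule.mem_iInf] at hI
      exact hI (s.localization P)
        ((h _).mpr ⟨valuationRing_localization hR s P, s.le_localization P⟩)
  · exact (isGLB_infimum X hX).2 fun t ht => ((h t).mp ht).2

end SemistarOperation

namespace UpClosedValuationSemistar

open SemistarOperation

variable {R K : Type*} [CommRing R] [Field K] [Algebra R K]

theorem isStable_inf [IsDomain R] [IsFractionRing R K] (hR : IsPruferDomain R)
    (X : UpClosedValuationSemistar R K) : X.inf.IsStable :=
  isStable_infimum _ (by rintro _ ⟨s, -, rfl⟩; exact isStable_of_valuationRing hR s.2)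

theorem inf_mono : Monotone (inf : UpClosedValuationSemistar R K → SemistarOperation R K) :=
  fun X Y h => (isGLB_infimum _ (Y.2.image _)).2
    fun _ ht => (isGLB_infimum _ (X.2.image _)).1 (Set.image_mono h ht)

theorem le_of_inf_le_inf [IsDomain R] [IsFractionRing R K] (hR : IsPruferDomain R)
    [TopologicalSpace.NoetherianSpace (PrimeSpectrum R)] {X Y : UpClosedValuationSemistar R K}
    (h : X.inf ≤ Y.inf) : X ≤ Y := by
  intro t ht
  obtain ⟨_, ⟨s, hs, rfl⟩, hst⟩ := exists_le_of_infimum_le hR (X.2.image Subtype.val)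
    (by rintro _ ⟨s, -, rfl⟩; exact s.2) t.2
    (h.trans ((isGLB_infimum _ (Y.2.image _)).1 ⟨t, ht, rfl⟩))
  exact X.1.upper hst hs

theorem exists_inf_eq [IsDomain R] [IsFractionRing R K] (hR : IsPruferDomain R)
    (hfin : ∀ I : Ideal R, I ≠ ⊤ → I.minimalPrimes.Finite) {s : SemistarOperation R K}
    (hs : s.IsStable) : ∃ X : UpClosedValuationSemistar R K, X.inf = s := by
  -- Localizing at the zero ideal gives overring `K`, so the set is nonempty.
  have hne : {t : ValuationSemistar R K | s ≤ t.1}.Nonempty :=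
    ⟨⟨s.localization ⊥, valuationRing_localization hR s ⊥⟩, s.le_localization ⊥⟩
  refine ⟨⟨⟨{t | s ≤ t.1}, fun _ _ htu (ht : s ≤ _) => ht.trans htu⟩, hne⟩, ?_⟩
  refine hs.infimum_eq hR hfin _ fun t => ⟨?_, fun ht => ⟨⟨t, ht.1⟩, ht.2, rfl⟩⟩
  rintro ⟨t, ht, rfl⟩
  exact ⟨t.2, ht⟩

end UpClosedValuationSemistar

theorem mainTheorem4 (R : Type*) [CommRing R] [IsDomain R] (hR : IsPruferDomain R)
    (K : Type*) [Field K] [Algebra R K] [IsFractionRing R K] :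
    ∃ Ψ : UpClosedValuationSemistar R K → StableSemistar R K,
      (∀ X, (Ψ X : SemistarOperation R K) = UpClosedValuationSemistar.inf X) ∧
      Monotone Ψ ∧
      ((∀ I : Ideal R, I ≠ ⊤ → I.minimalPrimes.Finite) → Function.Surjective Ψ) ∧
      (TopologicalSpace.NoetherianSpace (PrimeSpectrum R) →
        ∃ e : UpClosedValuationSemistar R K ≃o StableSemistar R K, ∀ X, e X = Ψ X) := by
  let Ψ : UpClosedValuationSemistar R K → StableSemistar R K :=
    fun X => ⟨X.inf, UpClosedValuationSemistar.isStable_inf hR X⟩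
  have hmono : Monotone Ψ := fun X Y h => UpClosedValuationSemistar.inf_mono h
  have hsurj : (∀ I : Ideal R, I ≠ ⊤ → I.minimalPrimes.Finite) → Function.Surjective Ψ := by
    intro hfin s
    obtain ⟨X, hX⟩ := UpClosedValuationSemistar.exists_inf_eq hR hfin s.2
    exact ⟨X, Subtype.ext hX⟩
  refine ⟨Ψ, fun _ => rfl, hmono, hsurj, fun hN => ?_⟩
  let f : UpClosedValuationSemistar R K ↪o StableSemistar R K :=
    OrderEmbedding.ofMapLEIff Ψ fun X Y =>
      ⟨fun h => UpClosedValuationSemistar.le_of_inf_le_inf hR h, fun h => hmono h⟩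
  exact ⟨RelIso.ofSurjective f
    (hsurj fun I _ => I.finite_minimalPrimes_of_noetherianSpace), fun _ => rfl⟩
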